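/- Let $K$ be a field of characteristic $0$ and $L$ an algebraically closed extension field of $K$ (for instance $K\subseteq\mathbb{C}$ and $L=\overline{K}$). Let $\chi(x,y)\in K[x,y]$ be monic of degree $n\ge 1$ in $y$ and have nonzero constant term $\chi(0,0)\neq 0$, and write $\chi'=\partial\chi/\partial y$. Let $P\subset\mathbb{R}^2$ be the Newton polygon of $\chi$, i.e. the convex hull of the exponent vectors $(i,j)$ of the nonzero terms $c_{ij}x^iy^j$ of $\chi$. For a nonzero Puiseux series $R$ in $1/x$ with coefficients in $L$ (an element of $\bigcup_{N\ge1}L((x^{-1/N}))$), write $R=c\,x^{h}+(\text{smaller powers of }x)$ with $c\ne0$, and put $h(R)=h$; the term $c\,x^{h}$ is called the highest term of $R$. Let $y^{(1)},\dots,y^{(n)}$ be the solutions of $\chi(x,y)=0$ in this field of Puiseux series, and assume that their highest terms are pairwise distinct. Then for every $(a,m)\in\mathbb{Z}^2_{\ge0}$: 1. the inequalities $$h\!\left(\frac{x^a\,(y^{(\ell)})^m}{\chi'(y^{(\ell)})}\right)<-1,\qquad \ell=1,\dots,n,$$ hold if and only if $(a+1,m+1)$ is an interior lattice point of $P$; 2.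 if the solutions are numbered so that $h_1\ge h_2\ge\cdots\ge h_n$, where $h_\ell=h(y^{(\ell)})$, then the inequalities $$a<h_1+\cdots+h_{\ell-1}+(n-\ell-m)\,h_\ell-1,\qquad \ell=1,\dots,n,$$ hold if and only if $(a+1,m+1)$ is an interior lattice point of $P$ (so they are equivalent to those in 1). -/

import Mathlib

open Polynomial
open scoped Polynomial.Bivariate

/-! Puiseux series in `t = 1/x` are realised inside the field of Hahn series `HahnSeries ℚ L`
in `t`: the coefficient at `q : ℚ` belongs to `t ^ q = x ^ (-q)`. -/

/-- The exponents of `z` have the bounded denominator `N`. -/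
def HasDenominator {L : Type*} [Field L] (z : HahnSeries ℚ L) (N : ℕ) : Prop :=
  0 < N ∧ ∀ q ∈ z.support, ∃ k : ℤ, q * N = k

theorem HasDenominator.mul_right {L : Type*} [Field L] {z : HahnSeries ℚ L} {N : ℕ}
    (h : HasDenominator z N) {M : ℕ} (hM : 0 < M) : HasDenominator z (N * M) := by
  refine ⟨Nat.mul_pos h.1 hM, fun q hq => ?_⟩
  obtain ⟨k, hk⟩ := h.2 q hq
  exact ⟨k * M, by push_cast; rw [← hk]; ring⟩

theorem HasDenominator.add {L : Type*} [Field L] {y z : HahnSeries ℚ L} {N : ℕ}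
    (hy : HasDenominator y N) (hz : HasDenominator z N) : HasDenominator (y + z) N := by
  refine ⟨hy.1, fun q hq => ?_⟩
  rcases HahnSeries.support_add_subset y z hq with h | h
  exacts [hy.2 q h, hz.2 q h]

theorem HasDenominator.mul {L : Type*} [Field L] {y z : HahnSeries ℚ L} {N : ℕ}
    (hy : HasDenominator y N) (hz : HasDenominator z N) : HasDenominator (y * z) N := by
  refine ⟨hy.1, fun q hq => ?_⟩
  obtain ⟨u, hu, v, hv, rfl⟩ := Set.mem_add.1 (HahnSeries.support_mul_subset hq)
  obtain ⟨k, hk⟩ := hy.2 u hu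
  obtain ⟨l, hl⟩ := hz.2 v hv
  exact ⟨k + l, by push_cast; rw [← hk, ← hl]; ring⟩

theorem hasDenominator_single {L : Type*} [Field L] (k : ℤ) (c : L) :
    HasDenominator (HahnSeries.single (k : ℚ) c) 1 := by
  refine ⟨one_pos, fun q hq => ⟨k, ?_⟩⟩
  have := HahnSeries.support_single_subset hq
  simp_all

theorem HasDenominator.inv {L : Type*} [Field L] {z : HahnSeries ℚ L} {N : ℕ}
    (h : HasDenominator z N) : HasDenominator z⁻¹ N := by
  have hN : (0 : ℚ) < N := by exact_mod_cast h.1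
  let f : ℤ →+ ℚ :=
    { toFun := fun k => k / N
      map_zero' := by simp
      map_add' := fun a b => by push_cast; ring }
  have hle : ∀ g g' : ℤ, f g ≤ f g' ↔ g ≤ g' := fun g g' => by
    change (g : ℚ) / N ≤ g' / N ↔ _
    rw [div_le_div_iff_of_pos_right hN]
    exact Int.cast_le
  have hinj : Function.Injective f := fun a b hab =>
    le_antisymm ((hle a b).1 hab.le) ((hle b a).1 hab.ge)
  let φ : HahnSeries ℤ L →+* HahnSeries ℚ L := HahnSeries.embDomainRingHom f hinj hle
  let e : ℤ ↪o ℚ := ⟨⟨f, hinj⟩, hle _ _⟩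
  have hφ : ∀ w, φ w = HahnSeries.embDomain e w := fun w => rfl
  let w : HahnSeries ℤ L :=
    { coeff := fun k => z.coeff (f k)
      isPWO_support' := by
        rw [Set.isPWO_iff_isWF, Set.isWF_iff_no_descending_seq]
        intro s hs hmem
        have hz := Set.isWF_iff_no_descending_seq.1 z.isWF_support
        exact hz (fun n => f (s n))
          (fun a b hab => lt_of_le_not_ge ((hle _ _).2 (hs hab).le)
            (fun hc => absurd ((hle _ _).1 hc) (not_le.2 (hs hab)))) hmem }
  have hzw : φ w = z := by
    ext q
    rw [hφ]
    by_cases hq : ∃ k : ℤ, q = f k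
    · obtain ⟨k, rfl⟩ := hq
      exact HahnSeries.embDomain_coeff (f := e) (x := w) (a := k)
    · rw [HahnSeries.embDomain_of_notMem_range]
      · by_contra hne
        obtain ⟨k, hk⟩ := h.2 q (Ne.symm hne)
        exact hq ⟨k, by change q = (k : ℚ) / N; rw [← hk]; field_simp⟩
      · rintro ⟨k, hk⟩
        exact hq ⟨k, hk.symm⟩
  refine ⟨h.1, fun q hq => ?_⟩
  rw [← hzw, ← map_inv₀, hφ] at hq
  obtain ⟨k, -, rfl⟩ := HahnSeries.support_embDomain_subset hq
  exact ⟨k, by change (k : ℚ) / N * N = k; field_simp⟩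

/-- The field `⋃_N L((x^{-1/N}))` of Puiseux series in `1/x` with coefficients in `L`. -/
noncomputable def PuiseuxAtInfinity (L : Type*) [Field L] :
    Subfield (HahnSeries ℚ L) where
  carrier := {z | ∃ N : ℕ, HasDenominator z N}
  mul_mem' := by
    rintro y z ⟨N, hN⟩ ⟨M, hM⟩
    exact ⟨N * M, (hN.mul_right hM.1).mul (Nat.mul_comm M N ▸ hM.mul_right hN.1)⟩
  add_mem' := by
    rintro y z ⟨N, hN⟩ ⟨M, hM⟩
    exact ⟨N * M, (hN.mul_right hM.1).add (Nat.mul_comm M N ▸ hM.mul_right hN.1)⟩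
  zero_mem' := ⟨1, by simpa using hasDenominator_single 0 (0 : L)⟩
  one_mem' := ⟨1, by simpa using hasDenominator_single 0 (1 : L)⟩
  neg_mem' := by
    rintro z ⟨N, hN⟩
    exact ⟨N, hN.1, fun q hq => hN.2 q (by simpa using hq)⟩
  inv_mem' := by
    rintro z ⟨N, hN⟩
    exact ⟨N, hN.inv⟩

namespace PuiseuxAtInfinity

/-- The constant series with value `c ∈ L`. -/
noncomputable def const (L : Type*) [Field L] : L →+* PuiseuxAtInfinity L :=
  HahnSeries.C.codRestrict (PuiseuxAtInfinity L)
    fun c => ⟨1, by simpa using hasDenominator_single 0 c⟩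

/-- The variable `x = t⁻¹` as a Puiseux series in `t = 1/x`. -/
noncomputable def x (L : Type*) [Field L] : PuiseuxAtInfinity L :=
  ⟨HahnSeries.single (-1) 1, 1, by simpa using hasDenominator_single (-1) (1 : L)⟩

/-- The highest exponent `h z` of `x` in a nonzero Puiseux series `z` in `1/x`
(the junk value at `z = 0` is `0`). -/
noncomputable def h {L : Type*} [Field L] (z : PuiseuxAtInfinity L) : ℚ :=
  -(z : HahnSeries ℚ L).order

/-- The highest term `c x ^ h` of a Puiseux series `c x ^ h + (smaller powers of x)`, `c ≠ 0`. -/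
noncomputable def highestTerm {L : Type*} [Field L] (z : PuiseuxAtInfinity L) : HahnSeries ℚ L :=
  HahnSeries.single (-h z) (z : HahnSeries ℚ L).leadingCoeff

/-- The value `χ(x, z)` of `χ ∈ K[x][y]` at `y = z`, for a Puiseux series `z` in `1/x` with
coefficients in an extension `L` of `K`. -/
noncomputable def evalAt {K L : Type*} [Field K] [Field L] [Algebra K L] (χ : K[X][Y])
    (z : PuiseuxAtInfinity L) : PuiseuxAtInfinity L :=
  eval₂ (eval₂RingHom ((const L).comp (algebraMap K L)) (x L)) z χ

end PuiseuxAtInfinity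

/-- The Newton polygon of `χ(x, y) = ∑ (χ.coeff j).coeff i * x ^ i * y ^ j` (an element of
`K[X][Y]`, the outer variable being `y`): the convex hull in the plane of the exponent vectors
`(i, j)` of its nonzero terms. -/
def newtonPolygon {K : Type*} [Field K] (χ : K[X][Y]) : Set (ℝ × ℝ) :=
  convexHull ℝ {p | ∃ i j : ℕ, (χ.coeff j).coeff i ≠ 0 ∧ p = ((i : ℝ), (j : ℝ))}

/-!
For a slope `s`, the Gauss norm of `χ` with `|x| = e` and `|y| = exp s` is `exp` of the maximum of
`i + s * j` over the exponent vectors `(i, j)` of `χ`. The Gauss norm is multiplicative, so the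
factorization `χ = ∏ (y - y_k)` identifies this support function of `P` as `∑ max (h_k, s)`.
It is piecewise affine in `s`, with breaks only at the `h_l`; hence inside the positive quadrant,
`P` is cut out by the inequalities `i + h_l * j ≤ ∑ max (h_k, h_l)`, one for each `l`.
On the other hand, `h (χ'(y_l)) = ∑_{k ≠ l} h (y_l - y_k)`, and because the highest terms are
distinct, `h (y_l - y_k) = max (h_l, h_k)`. So the inequality `h (x^a y_l^m / χ'(y_l)) < -1` is the
strict form of the `l`-th one at the point `(a + 1, m + 1)`.
-/

section SumMax

variable {ι R : Type*} [Fintype ι] [CommRing R] [LinearOrder R]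

theorem sum_max_eq_of_forall_le [DecidableEq ι] {h : ι → R} {s : R} {T : Finset ι}
    (hT : ∀ k ∈ T, s ≤ h k) (hTc : ∀ k ∉ T, h k ≤ s) :
    ∑ k, max (h k) s = ∑ k ∈ T, h k + Tᶜ.card * s := by
  rw [← Finset.sum_add_sum_compl T, Finset.sum_congr rfl fun k hk => max_eq_left (hT k hk),
    Finset.sum_congr rfl fun k hk => max_eq_right (hTc k (Finset.mem_compl.1 hk)),
    Finset.sum_const, nsmul_eq_mul]

theorem sum_max_eq_of_antitone {n : ℕ} {h : Fin n → R} (hh : Antitone h) (l : Fin n) :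
    ∑ k, max (h k) (h l) = ∑ k ∈ Finset.Iio l, h k + ((n : R) - (l : ℕ)) * h l := by
  rw [sum_max_eq_of_forall_le (T := Finset.Iio l) (fun k hk => hh (Finset.mem_Iio.1 hk).le)
    fun k hk => hh (by simpa using hk), Finset.card_compl, Fintype.card_fin, Fin.card_Iio,
    Nat.cast_sub l.2.le]

-- The function is affine between consecutive nodes `h l`, with slope `#{k | h k ≤ s} - j`:
-- according to the sign of this slope, move from `s` to the next node on its left or right.
theorem exists_sum_max_sub_mul_le [IsStrictOrderedRing R] (h : ι → R) {j : R} (hj : 0 < j)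
    (hj' : j < Fintype.card ι) (s : R) :
    ∃ l, ∑ k, max (h k) (h l) - h l * j ≤ ∑ k, max (h k) s - s * j := by
  classical
  set T : Finset ι := {k | s < h k}
  have mem_T {k : ι} : k ∈ T ↔ s < h k := Finset.mem_filter_univ k
  have sum_s := sum_max_eq_of_forall_le (fun k hk => (mem_T.1 hk).le)
    fun k hk => not_lt.1 (mt mem_T.2 hk)
  rcases le_or_gt j Tᶜ.card with slope_nonneg | slope_neg
  · have nodes_left : Tᶜ.Nonempty := Finset.card_pos.1 (by exact_mod_cast hj.trans_le slope_nonneg)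
    obtain ⟨l, hl, hmax⟩ := Tᶜ.exists_max_image h nodes_left
    have hls : h l ≤ s := not_lt.1 (mt mem_T.2 (Finset.mem_compl.1 hl))
    refine ⟨l, ?_⟩
    rw [sum_s, sum_max_eq_of_forall_le (fun k hk => hls.trans (mem_T.1 hk).le)
      fun k hk => hmax k (Finset.mem_compl.2 hk)]
    linarith [mul_nonneg (sub_nonneg.2 slope_nonneg) (sub_nonneg.2 hls)]
  · have nodes_right : T.Nonempty := by
      by_contra hT
      rw [Finset.not_nonempty_iff_eq_empty.1 hT, Finset.compl_empty, Finset.card_univ] at slope_neg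
      exact lt_asymm hj' slope_neg
    obtain ⟨l, hl, hmin⟩ := T.exists_min_image h nodes_right
    have hsl : s ≤ h l := (mem_T.1 hl).le
    refine ⟨l, ?_⟩
    rw [sum_s, sum_max_eq_of_forall_le hmin fun k hk => (not_lt.1 (mt mem_T.2 hk)).trans hsl]
    linarith [mul_nonneg (sub_nonneg.2 slope_neg.le) (sub_nonneg.2 hsl)]

end SumMax

section ConvexHull

variable {E : Type*} [AddCommGroup E] [Module ℝ E] [TopologicalSpace E] [IsTopologicalAddGroup E]
  [ContinuousSMul ℝ E] {S : Set E}

theorem lt_of_mem_interior_convexHull {f : StrongDual ℝ E} (hf : f ≠ 0) {c : ℝ}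
    (hS : ∀ p ∈ S, f p ≤ c) {p : E} (hp : p ∈ interior (convexHull ℝ S)) : f p < c := by
  have hull_le : convexHull ℝ S ⊆ f ⁻¹' Set.Iic c :=
    convexHull_min hS (convex_halfSpace_le f.toLinearMap.isLinear c)
  have := interior_mono hull_le hp
  rwa [← (f.isOpenMap_of_ne_zero hf).preimage_interior_eq_interior_preimage f.continuous,
    interior_Iic] at this

theorem mem_convexHull_of_forall_exists_le [LocallyConvexSpace ℝ E] [T2Space E]
    (hS : S.Finite) {p : E} (hp : ∀ f : StrongDual ℝ E, ∃ q ∈ S, f p ≤ f q) :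
    p ∈ convexHull ℝ S := by
  by_contra hnot
  obtain ⟨f, u, hSu, hup⟩ := geometric_hahn_banach_closed_point (convex_convexHull ℝ S)
    (hS.isClosed_convexHull ℝ) hnot
  obtain ⟨q, hq, hpq⟩ := hp f
  exact (hpq.trans_lt ((hSu q (subset_convexHull ℝ S hq)).trans hup)).false

end ConvexHull

section PlanarPolygon

variable {ι : Type*} [Fintype ι] [Nonempty ι] {h : ι → ℝ} {S : Set (ℝ × ℝ)}

theorem lt_card_of_forall_add_mul_lt_sum_max (hnonneg : ∀ s, 0 ≤ ∑ k, max (h k) s) {p : ℝ × ℝ}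
    (hp : 0 < p.1) (hlt : ∀ l, p.1 + h l * p.2 < ∑ k, max (h k) (h l)) :
    p.2 < Fintype.card ι := by
  obtain ⟨l, hl⟩ := Finite.exists_max h
  have sum_eq : ∑ k, max (h k) (h l) = Fintype.card ι * h l := by
    simp [max_eq_right (hl _)]
  have hl_nonneg : 0 ≤ Fintype.card ι * h l := sum_eq ▸ hnonneg (h l)
  have := hlt l
  rw [sum_eq] at this
  have pos : 0 < (Fintype.card ι - p.2) * h l := by linarith
  have h0 := nonneg_of_mul_nonneg_right hl_nonneg (Nat.cast_pos.2 Fintype.card_pos)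
  linarith [pos_of_mul_pos_left pos h0]

theorem mem_convexHull_of_forall_add_mul_lt_sum_max (hS : S.Finite) (hzero : (0, 0) ∈ S)
    (hcard : (0, (Fintype.card ι : ℝ)) ∈ S)
    (hsupp : ∀ s, IsGreatest ((fun p : ℝ × ℝ => p.1 + s * p.2) '' S) (∑ k, max (h k) s))
    {p : ℝ × ℝ} (hp₁ : 0 < p.1) (hp₂ : 0 < p.2)
    (hp : ∀ l, p.1 + h l * p.2 < ∑ k, max (h k) (h l)) : p ∈ convexHull ℝ S := by
  have hpn : p.2 < Fintype.card ι := lt_card_of_forall_add_mul_lt_sum_max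
    (fun s => (hsupp s).2 ⟨_, hzero, by simp⟩) hp₁ hp
  refine mem_convexHull_of_forall_exists_le hS fun f => ?_
  obtain ⟨α, β, hf⟩ : ∃ α β : ℝ, ∀ r : ℝ × ℝ, f r = α * r.1 + β * r.2 := by
    refine ⟨f (1, 0), f (0, 1), fun r => ?_⟩
    have : r = r.1 • (1, 0) + r.2 • (0, 1) := by ext <;> simp
    conv_lhs => rw [this]
    simp only [map_add, map_smul, smul_eq_mul, mul_comm]
  simp only [hf]
  rcases le_or_gt α 0 with hα | hα
  · rcases le_or_gt β 0 with hβ | hβ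
    · exact ⟨_, hzero, by nlinarith⟩
    · exact ⟨_, hcard, by nlinarith⟩
  · obtain ⟨⟨q, hq, hqs⟩, -⟩ := hsupp (β / α)
    obtain ⟨l, hl⟩ := exists_sum_max_sub_mul_le h hp₂ hpn (β / α)
    have : p.1 + β / α * p.2 ≤ q.1 + β / α * q.2 := by
      have := hp l
      dsimp only at hqs
      linarith
    have scale (r : ℝ × ℝ) : α * r.1 + β * r.2 = α * (r.1 + β / α * r.2) := by field_simp
    refine ⟨q, hq, ?_⟩
    rw [scale, scale]
    gcongr

theorem mem_interior_convexHull_iff (hS : S.Finite) (hnonneg : ∀ p ∈ S, 0 ≤ p.1 ∧ 0 ≤ p.2)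
    (hzero : (0, 0) ∈ S) (hcard : (0, (Fintype.card ι : ℝ)) ∈ S)
    (hsupp : ∀ s, IsGreatest ((fun p : ℝ × ℝ => p.1 + s * p.2) '' S) (∑ k, max (h k) s))
    {p : ℝ × ℝ} : p ∈ interior (convexHull ℝ S) ↔
      0 < p.1 ∧ 0 < p.2 ∧ ∀ l, p.1 + h l * p.2 < ∑ k, max (h k) (h l) := by
  constructor
  · intro hp
    have strict (α β c : ℝ) (hne : α ≠ 0 ∨ β ≠ 0) (hle : ∀ q ∈ S, α * q.1 + β * q.2 ≤ c) :
        α * p.1 + β * p.2 < c := by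
      refine lt_of_mem_interior_convexHull
        (f := α • ContinuousLinearMap.fst ℝ ℝ ℝ + β • ContinuousLinearMap.snd ℝ ℝ ℝ)
        (fun hf => ?_) hle hp
      have hα : α = 0 := by simpa using DFunLike.congr_fun hf (1, 0)
      have hβ : β = 0 := by simpa using DFunLike.congr_fun hf (0, 1)
      exact hne.elim (· hα) (· hβ)
    refine ⟨?_, ?_, fun l => ?_⟩
    · linarith [strict (-1) 0 0 (by simp) fun q hq => by linarith [(hnonneg q hq).1]]
    · linarith [strict 0 (-1) 0 (by simp) fun q hq => by linarith [(hnonneg q hq).2]]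
    · linarith [strict 1 (h l) (∑ k, max (h k) (h l)) (by simp) fun q hq => by
        linarith [(hsupp (h l)).2 (Set.mem_image_of_mem _ hq)]]
  · intro hp
    refine interior_maximal (t := {p : ℝ × ℝ | 0 < p.1 ∧ 0 < p.2 ∧ ∀ l, p.1 + h l * p.2 < _})
      (fun q hq => mem_convexHull_of_forall_add_mul_lt_sum_max hS hzero hcard hsupp
        hq.1 hq.2.1 hq.2.2) ?_ hp
    simp only [Set.ofPred_and, Set.ofPred_forall]
    exact (isOpen_lt continuous_const continuous_fst).inter
      ((isOpen_lt continuous_const continuous_snd).inter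
        (isOpen_iInter_of_finite fun l => isOpen_lt (by fun_prop) continuous_const))

end PlanarPolygon

section GaussNorm

variable {R : Type*} [CommRing R]

theorem eq_nodal_of_monic [IsDomain R] {ι : Type*} [Fintype ι] {p : R[X]} (hp : p.Monic)
    (hdeg : p.natDegree = Fintype.card ι) {y : ι → R} (hy : Function.Injective y)
    (hroot : ∀ l, p.eval (y l) = 0) : p = Lagrange.nodal Finset.univ y := by
  have hdegree : p.degree = Finset.univ.card (α := ι) := by
    rw [degree_eq_natDegree hp.ne_zero, hdeg, Finset.card_univ]
  refine eq_of_degree_le_of_eval_index_eq Finset.univ hy.injOn hdegree.le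
    (hdegree.trans Lagrange.degree_nodal.symm) ?_ fun l hl => ?_
  · rw [hp.leadingCoeff, Lagrange.nodal_monic.leadingCoeff]
  · rw [hroot, Lagrange.eval_nodal_at_node hl]

variable {v : AbsoluteValue R ℝ}

theorem gaussNorm_X_sub_C [Nontrivial R] (v : AbsoluteValue R ℝ) {c : ℝ} (hc : 0 ≤ c) (r : R) :
    (X - C r).gaussNorm v c = max (v r) c := by
  have coeff_zero : v ((X - C r).coeff 0) * c ^ 0 = v r := by simp
  have coeff_one : v ((X - C r).coeff 1) * c ^ 1 = c := by simp
  refine le_antisymm ?_ (max_le ?_ ?_)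
  · obtain ⟨i, hi⟩ := exists_eq_gaussNorm v c (X - C r)
    rw [hi]
    rcases i with _ | _ | i
    · exact coeff_zero.trans_le (le_max_left _ _)
    · exact coeff_one.trans_le (le_max_right _ _)
    · simp [coeff_X, hc]
  · exact coeff_zero.symm.trans_le (le_gaussNorm v _ hc 0)
  · exact coeff_one.symm.trans_le (le_gaussNorm v _ hc 1)

theorem gaussNorm_nodal [Nontrivial R] (hv : IsNonarchimedean v) {c : ℝ} (hc : 0 < c) {ι : Type*}
    (s : Finset ι) (y : ι → R) : (Lagrange.nodal s y).gaussNorm v c = ∏ l ∈ s, max (v (y l)) c := by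
  have := gaussNorm_isAbsoluteValue hv hc
  rw [Lagrange.nodal_eq]
  exact (map_prod (IsAbsoluteValue.toAbsoluteValue (gaussNorm v c)) _ s).trans
    (Finset.prod_congr rfl fun l _ => gaussNorm_X_sub_C v hc.le (y l))

theorem apply_eval₂_eq_pow_natDegree {K : Type*} [Semiring K] (hv : IsNonarchimedean v)
    {φ : K →+* R} (hφ : ∀ a ≠ 0, v (φ a) = 1) {x : R} (hx : 1 < v x) {p : K[X]} (hp : p ≠ 0) :
    v (p.eval₂ φ x) = v x ^ p.natDegree := by
  have : Nontrivial R := nontrivial_of_ne x 0 (v.ne_zero_iff.1 (zero_lt_one.trans hx).ne')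
  have v_term {i : ℕ} (hi : p.coeff i ≠ 0) : v (φ (p.coeff i) * x ^ i) = v x ^ i := by
    rw [map_mul, map_pow, hφ _ hi, one_mul]
  have hlead : p.coeff p.natDegree ≠ 0 := leadingCoeff_ne_zero.2 hp
  rw [eval₂_eq_sum, Polynomial.sum, hv.apply_sum_eq_of_lt (fun a => (v.map_neg a).symm)
    (natDegree_mem_support_of_nonzero hp), v_term hlead]
  intro i hi hne
  rw [v_term (mem_support_iff.1 hi), v_term hlead]
  exact pow_lt_pow_right₀ hx ((le_natDegree_of_mem_supp i hi).lt_of_ne hne)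

end GaussNorm

namespace PuiseuxAtInfinity

section AbsoluteValue

variable {L : Type*} [Field L] {y z : PuiseuxAtInfinity L}

theorem h_mul (hy : y ≠ 0) (hz : z ≠ 0) : h (y * z) = h y + h z := by
  simp only [h, MulMemClass.coe_mul]
  rw [HahnSeries.order_mul (by simpa using hy) (by simpa using hz), neg_add]

theorem h_add_le (hyz : y + z ≠ 0) : h (y + z) ≤ max (h y) (h z) := by
  rw [h, h, h, max_neg_neg, neg_le_neg_iff]
  exact HahnSeries.min_order_le_order_add (Subtype.coe_ne_coe.2 hyz)

open scoped Classical in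
theorem isNonarchimedean_exp_h :
    IsNonarchimedean fun z : PuiseuxAtInfinity L => if z = 0 then 0 else Real.exp (h z) := by
  intro y z
  by_cases hyz : y + z = 0
  · simp only [hyz, if_true]
    positivity
  by_cases hy : y = 0
  · simp [hy]
  by_cases hz : z = 0
  · simp [hz]
  simp only [hyz, hy, hz, if_false]
  rw [← Real.exp_monotone.map_max, Real.exp_le_exp]
  exact_mod_cast h_add_le hyz

open scoped Classical in
/-- The absolute value `z ↦ exp (h z)` on the field of Puiseux series in `1/x`. It turns the
calculus of highest exponents into that of a nonarchimedean absolute value with `|x| = e`. -/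
noncomputable def abv (L : Type*) [Field L] : AbsoluteValue (PuiseuxAtInfinity L) ℝ where
  toFun z := if z = 0 then 0 else Real.exp (h z)
  map_mul' y z := by
    by_cases hy : y = 0
    · simp [hy]
    by_cases hz : z = 0
    · simp [hz]
    simp [hy, hz, h_mul hy hz, Real.exp_add]
  nonneg' z := by positivity
  eq_zero' z := by simp
  add_le' y z := isNonarchimedean_exp_h.add_le fun z => by positivity

theorem isNonarchimedean_abv : IsNonarchimedean (abv L) :=
  isNonarchimedean_exp_h

theorem abv_of_ne_zero (hz : z ≠ 0) : abv L z = Real.exp (h z) :=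
  if_neg hz

theorem h_eq_of_abv_eq_exp {r : ℝ} (hz : abv L z = Real.exp r) : (h z : ℝ) = r := by
  have hz0 : z ≠ 0 := (abv L).ne_zero_iff.1 (hz ▸ Real.exp_ne_zero r)
  rwa [abv_of_ne_zero hz0, Real.exp_eq_exp] at hz

theorem abv_const {c : L} (hc : c ≠ 0) : abv L (const L c) = 1 := by
  rw [abv_of_ne_zero ((_root_.map_ne_zero _).2 hc), Real.exp_eq_one_iff, Rat.cast_eq_zero, h,
    neg_eq_zero]
  exact HahnSeries.order_C

theorem abv_x : abv L (x L) = Real.exp 1 := by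
  have order_x : (x L : HahnSeries ℚ L).order = -1 := HahnSeries.order_single one_ne_zero
  have x_ne_zero : x L ≠ 0 := by
    rw [← Subtype.coe_ne_coe]
    exact HahnSeries.single_ne_zero one_ne_zero
  rw [abv_of_ne_zero x_ne_zero, h, order_x, neg_neg, Rat.cast_one]

theorem coeff_sub_ne_zero_of_highestTerm_ne (hyz : highestTerm y ≠ highestTerm z)
    (hh : h y = h z) : (y - z : HahnSeries ℚ L).coeff (-h y) ≠ 0 := by
  have coeff_neg_h (w : PuiseuxAtInfinity L) :
      (w : HahnSeries ℚ L).coeff (-h w) = (w : HahnSeries ℚ L).leadingCoeff := by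
    rw [h, neg_neg, HahnSeries.leadingCoeff_eq]
  rw [HahnSeries.coeff_sub, coeff_neg_h, hh, coeff_neg_h, sub_ne_zero]
  exact fun hlead => hyz (by rw [highestTerm, highestTerm, hh, hlead])

theorem abv_sub_of_highestTerm_ne (hy : y ≠ 0) (hz : z ≠ 0)
    (hyz : highestTerm y ≠ highestTerm z) : abv L (y - z) = max (abv L y) (abv L z) := by
  by_cases hh : h y = h z
  · have hcoeff := coeff_sub_ne_zero_of_highestTerm_ne hyz hh
    have hsub : y - z ≠ 0 := fun h0 => hcoeff (by simp [sub_eq_zero.1 h0])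
    have h_le : h y ≤ h (y - z) := le_neg_of_le_neg (HahnSeries.order_le_of_coeff_ne_zero hcoeff)
    refine le_antisymm ?_ ?_
    · simpa only [← sub_eq_add_neg, AbsoluteValue.map_neg] using isNonarchimedean_abv y (-z)
    rw [abv_of_ne_zero hy, abv_of_ne_zero hz, abv_of_ne_zero hsub, ← hh, max_self]
    gcongr
  · have abv_ne : abv L y ≠ abv L z := by simpa [abv_of_ne_zero, hy, hz] using hh
    rw [sub_eq_add_neg, isNonarchimedean_abv.add_eq_max_of_ne, AbsoluteValue.map_neg]
    rwa [AbsoluteValue.map_neg]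

end AbsoluteValue

section Evaluation

variable {K L : Type*} [Field K] [Field L] [Algebra K L]

/-- The embedding of `K[x]` into the Puiseux series in `1/x`. Through it `χ ∈ K[x][y]` becomes a
polynomial in `y` over a field with a nonarchimedean absolute value. -/
noncomputable def ofPolynomial (K L : Type*) [Field K] [Field L] [Algebra K L] :
    K[X] →+* PuiseuxAtInfinity L :=
  eval₂RingHom ((const L).comp (algebraMap K L)) (x L)

theorem evalAt_eq_eval (χ : K[X][Y]) (z : PuiseuxAtInfinity L) :
    evalAt χ z = (χ.map (ofPolynomial K L)).eval z :=
  eval₂_eq_eval_map _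

theorem abv_ofPolynomial {p : K[X]} (hp : p ≠ 0) :
    abv L (ofPolynomial K L p) = Real.exp p.natDegree := by
  have hx : 1 < abv L (x L) := by rw [abv_x]; exact Real.one_lt_exp_iff.2 one_pos
  rw [ofPolynomial, coe_eval₂RingHom, apply_eval₂_eq_pow_natDegree isNonarchimedean_abv
    (φ := (const L).comp (algebraMap K L)) (fun a ha => abv_const ((_root_.map_ne_zero _).2 ha))
    hx hp, abv_x, Real.exp_one_pow]

theorem ofPolynomial_injective : Function.Injective (ofPolynomial K L) :=
  (injective_iff_map_eq_zero _).2 fun p hp => by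
    by_contra hp0
    exact Real.exp_ne_zero _ ((abv_ofPolynomial hp0).symm.trans (hp ▸ map_zero (abv L)))

theorem ne_zero_of_evalAt_eq_zero {χ : K[X][Y]} (hχ : χ.coeff 0 ≠ 0) {z : PuiseuxAtInfinity L}
    (hz : evalAt χ z = 0) : z ≠ 0 := by
  rintro rfl
  rw [evalAt_eq_eval, ← coeff_zero_eq_eval_zero, coeff_map] at hz
  exact hχ (ofPolynomial_injective (hz.trans (map_zero _).symm))

variable {ι : Type*} [Fintype ι] {χ : K[X][Y]} {y : ι → PuiseuxAtInfinity L}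

theorem map_ofPolynomial_eq_nodal (hχ : χ.Monic) (hdeg : χ.natDegree = Fintype.card ι)
    (hy : Function.Injective y) (hroot : ∀ l, evalAt χ (y l) = 0) :
    χ.map (ofPolynomial K L) = Lagrange.nodal Finset.univ y :=
  eq_nodal_of_monic (hχ.map _) ((hχ.natDegree_map _).trans hdeg) hy fun l =>
    (evalAt_eq_eval χ (y l)).symm.trans (hroot l)

theorem evalAt_derivative [DecidableEq ι]
    (hχ : χ.map (ofPolynomial K L) = Lagrange.nodal Finset.univ y) (l : ι) :
    evalAt (derivative χ) (y l) = ∏ k ∈ Finset.univ.erase l, (y l - y k) := by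
  rw [evalAt_eq_eval, ← derivative_map, hχ,
    Lagrange.eval_nodal_derivative_eval_node_eq (Finset.mem_univ l), Lagrange.eval_nodal]

theorem abv_evalAt_derivative (hχ : χ.map (ofPolynomial K L) = Lagrange.nodal Finset.univ y)
    (hy : ∀ l, y l ≠ 0) (hdistinct : Function.Injective fun l => highestTerm (y l)) (l : ι) :
    abv L (evalAt (derivative χ) (y l)) =
      Real.exp (∑ k, max (h (y k) : ℝ) (h (y l)) - h (y l)) := by
  classical
  have abv_factor : ∀ k ∈ Finset.univ.erase l,
      abv L (y l - y k) = Real.exp (max (h (y k) : ℝ) (h (y l))) := fun k hk => by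
    rw [abv_sub_of_highestTerm_ne (hy l) (hy k) (hdistinct.ne (Finset.ne_of_mem_erase hk).symm),
      abv_of_ne_zero (hy l), abv_of_ne_zero (hy k), max_comm, Real.exp_monotone.map_max]
  rw [evalAt_derivative hχ, map_prod, Finset.prod_congr rfl abv_factor, ← Real.exp_sum,
    ← Finset.add_sum_erase _ _ (Finset.mem_univ l), max_self, add_sub_cancel_left]

theorem h_div_evalAt_derivative (hχ : χ.map (ofPolynomial K L) = Lagrange.nodal Finset.univ y)
    (hy : ∀ l, y l ≠ 0) (hdistinct : Function.Injective fun l => highestTerm (y l)) (a m : ℕ)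
    (l : ι) : (h (x L ^ a * y l ^ m / evalAt (derivative χ) (y l)) : ℝ) =
      a + (m + 1) * h (y l) - ∑ k, max (h (y k) : ℝ) (h (y l)) := by
  apply h_eq_of_abv_eq_exp
  rw [map_div₀, map_mul, map_pow, map_pow, abv_x, abv_of_ne_zero (hy l),
    abv_evalAt_derivative hχ hy hdistinct, ← Real.exp_nat_mul, ← Real.exp_nat_mul, ← Real.exp_add,
    ← Real.exp_sub]
  congr 1
  ring

end Evaluation

end PuiseuxAtInfinity

section NewtonPolygon

open PuiseuxAtInfinity

/-- The exponent vectors `(i, j)` of the nonzero terms of `χ(x, y)`, whose convex hull is the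
Newton polygon of `χ`. -/
def newtonSupport {K : Type*} [Field K] (χ : K[X][Y]) : Set (ℝ × ℝ) :=
  {p | ∃ i j : ℕ, (χ.coeff j).coeff i ≠ 0 ∧ p = ((i : ℝ), (j : ℝ))}

variable {K L : Type*} [Field K] [Field L] [Algebra K L] {χ : K[X][Y]}

theorem mem_newtonSupport {i j : ℕ} :
    ((i : ℝ), (j : ℝ)) ∈ newtonSupport χ ↔ (χ.coeff j).coeff i ≠ 0 := by
  simp [newtonSupport]

theorem newtonSupport_finite (χ : K[X][Y]) : (newtonSupport χ).Finite := by
  refine ((χ.support.finite_toSet.biUnion fun j _ =>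
    (χ.coeff j).support.finite_toSet.image fun i : ℕ => ((i : ℝ), (j : ℝ)))).subset ?_
  rintro _ ⟨i, j, hij, rfl⟩
  refine Set.mem_biUnion (x := j) ?_ (Set.mem_image_of_mem _ (mem_support_iff.2 hij))
  exact mem_support_iff.2 fun hj => hij (by rw [hj, coeff_zero])

theorem gaussNorm_term_map_ofPolynomial {j : ℕ} (hj : χ.coeff j ≠ 0) (s : ℝ) :
    abv L ((χ.map (ofPolynomial K L)).coeff j) * Real.exp s ^ j =
      Real.exp ((χ.coeff j).natDegree + s * j) := by
  rw [coeff_map, abv_ofPolynomial hj, ← Real.exp_nat_mul, ← Real.exp_add, mul_comm s]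

theorem isGreatest_newtonSupport {r s : ℝ}
    (hr : (χ.map (ofPolynomial K L)).gaussNorm (abv L) (Real.exp s) = Real.exp r) :
    IsGreatest ((fun p : ℝ × ℝ => p.1 + s * p.2) '' newtonSupport χ) r := by
  constructor
  · obtain ⟨j, hj⟩ := exists_eq_gaussNorm (abv L) (Real.exp s) (χ.map (ofPolynomial K L))
    have hχj : χ.coeff j ≠ 0 := by
      rintro h0
      simp [h0, hr] at hj
    rw [hr, gaussNorm_term_map_ofPolynomial hχj, Real.exp_eq_exp] at hj
    exact ⟨_, mem_newtonSupport.2 (leadingCoeff_ne_zero.2 hχj), hj.symm⟩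
  · rintro _ ⟨_, ⟨i, j, hij, rfl⟩, rfl⟩
    have hχj : χ.coeff j ≠ 0 := fun hj => hij (by rw [hj, coeff_zero])
    have term_le := le_gaussNorm (abv L) (χ.map (ofPolynomial K L)) (Real.exp_nonneg s) j
    rw [hr, gaussNorm_term_map_ofPolynomial hχj, Real.exp_le_exp] at term_le
    have : (i : ℝ) ≤ (χ.coeff j).natDegree := mod_cast le_natDegree_of_ne_zero hij
    dsimp only
    linarith

variable {ι : Type*} [Fintype ι] {y : ι → PuiseuxAtInfinity L}

theorem gaussNorm_abv_nodal (hy : ∀ l, y l ≠ 0) (s : ℝ) :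
    (Lagrange.nodal Finset.univ y).gaussNorm (abv L) (Real.exp s) =
      Real.exp (∑ k, max (h (y k) : ℝ) s) := by
  rw [gaussNorm_nodal isNonarchimedean_abv (Real.exp_pos s), Real.exp_sum]
  exact Finset.prod_congr rfl fun k _ => by
    rw [abv_of_ne_zero (hy k), Real.exp_monotone.map_max]

theorem mem_interior_newtonPolygon_iff [Nonempty ι] (hmonic : χ.Monic)
    (hdeg : χ.natDegree = Fintype.card ι) (hconst : (χ.coeff 0).coeff 0 ≠ 0)
    (hχ : χ.map (ofPolynomial K L) = Lagrange.nodal Finset.univ y) (hy : ∀ l, y l ≠ 0)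
    {p : ℝ × ℝ} : p ∈ interior (newtonPolygon χ) ↔
      0 < p.1 ∧ 0 < p.2 ∧ ∀ l, p.1 + h (y l) * p.2 < ∑ k, max (h (y k) : ℝ) (h (y l)) := by
  refine mem_interior_convexHull_iff (S := newtonSupport χ) (h := fun l => (h (y l) : ℝ))
    (newtonSupport_finite χ) ?_ (mod_cast mem_newtonSupport.2 hconst) ?_
    fun s => isGreatest_newtonSupport (hχ ▸ gaussNorm_abv_nodal hy s)
  · rintro _ ⟨i, j, -, rfl⟩
    exact ⟨i.cast_nonneg, j.cast_nonneg⟩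
  · have htop : (χ.coeff (Fintype.card ι)).coeff 0 ≠ 0 := by
      rw [← hdeg, hmonic.coeff_natDegree, coeff_one_zero]
      exact one_ne_zero
    exact mod_cast mem_newtonSupport.2 htop

end NewtonPolygon

open PuiseuxAtInfinity in
theorem lemma5p2_general {K L : Type*} [Field K] [Field L] [Algebra K L]
    (χ : K[X][Y]) (n : ℕ) (hn : 0 < n)
    (hmonic : χ.Monic) (hdeg : χ.natDegree = n) (hconst : (χ.coeff 0).coeff 0 ≠ 0)
    (y : Fin n → PuiseuxAtInfinity L) (hroot : ∀ l, evalAt χ (y l) = 0)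
    (hdistinct : Function.Injective fun l => highestTerm (y l)) (a m : ℕ) :
    ((∀ l, h (x L ^ a * y l ^ m / evalAt (derivative χ) (y l)) < -1) ↔
        ((a : ℝ) + 1, (m : ℝ) + 1) ∈ interior (newtonPolygon χ)) ∧
    ((Antitone fun l => h (y l)) →
      ((∀ l : Fin n, (a : ℚ) < (∑ k ∈ Finset.Iio l, h (y k)) +
          ((n : ℚ) - ((l : ℕ) + 1) - m) * h (y l) - 1) ↔
        ((a : ℝ) + 1, (m : ℝ) + 1) ∈ interior (newtonPolygon χ))) := by
  have : Nonempty (Fin n) := ⟨0, hn⟩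
  have hcard : χ.natDegree = Fintype.card (Fin n) := hdeg.trans (Fintype.card_fin n).symm
  have hy (l) : y l ≠ 0 :=
    ne_zero_of_evalAt_eq_zero (fun h0 => hconst (by rw [h0, coeff_zero])) (hroot l)
  have hχ := map_ofPolynomial_eq_nodal hmonic hcard
    (Function.Injective.of_comp (f := highestTerm) hdistinct) hroot
  have mem_iff : ((a : ℝ) + 1, (m : ℝ) + 1) ∈ interior (newtonPolygon χ) ↔
      ∀ l, (a + 1 : ℝ) + h (y l) * (m + 1) < ∑ k, max (h (y k) : ℝ) (h (y l)) :=
    (mem_interior_newtonPolygon_iff hmonic hcard hconst hχ hy).trans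
      ((and_iff_right (by positivity)).trans (and_iff_right (by positivity)))
  rw [mem_iff]
  refine ⟨forall_congr' fun l => ?_, fun hanti => forall_congr' fun l => ?_⟩
  · rw [← Rat.cast_lt (K := ℝ), h_div_evalAt_derivative hχ hy hdistinct]
    push_cast
    constructor <;> intro <;> linarith
  · have sum_max := sum_max_eq_of_antitone (R := ℝ) (Rat.cast_mono.comp_antitone hanti) l
    simp only [Function.comp_apply] at sum_max
    rw [sum_max, ← Rat.cast_lt (K := ℝ)]
    push_cast
    constructor <;> intro <;> linarith

theorem lemma5p2 {K L : Type*} [Field K] [CharZero K] [Field L] [Algebra K L] [IsAlgClosed L]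
    (χ : K[X][Y]) (n : ℕ) (hn : 0 < n)
    -- `χ` is monic of degree `n` in `y`, with nonzero constant term
    (hmonic : χ.Monic) (hdeg : χ.natDegree = n)
    (hconst : (χ.coeff 0).coeff 0 ≠ 0)
    -- the roots of `χ` as Puiseux series in `1/x`: `n` solutions with distinct highest terms
    -- (in particular `n` distinct solutions, hence all of them)
    (y : Fin n → PuiseuxAtInfinity L)
    (hroot : ∀ l, PuiseuxAtInfinity.evalAt χ (y l) = 0)
    (hdistinct : Function.Injective fun l => PuiseuxAtInfinity.highestTerm (y l))
    (a m : ℕ) :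
    -- Abel's inequalities hold iff `(a + 1, m + 1)` is in the interior of the Newton polygon
    ((∀ l, PuiseuxAtInfinity.h (PuiseuxAtInfinity.x L ^ a * y l ^ m /
          PuiseuxAtInfinity.evalAt (derivative χ) (y l)) < -1) ↔
        ((a : ℝ) + 1, (m : ℝ) + 1) ∈ interior (newtonPolygon χ)) ∧
    -- and, if `h₁ ≥ ⋯ ≥ hₙ`, both are equivalent to the explicit form of the inequalities;
    -- the index `l : Fin n` stands for `ℓ = l + 1`
    ((Antitone fun l => PuiseuxAtInfinity.h (y l)) →
      ((∀ l : Fin n, (a : ℚ) < (∑ k ∈ Finset.Iio l, PuiseuxAtInfinity.h (y k)) +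
          ((n : ℚ) - ((l : ℕ) + 1) - m) * PuiseuxAtInfinity.h (y l) - 1) ↔
        ((a : ℝ) + 1, (m : ℝ) + 1) ∈ interior (newtonPolygon χ))) :=
  lemma5p2_general χ n hn hmonic hdeg hconst y hroot hdistinct a m
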